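/- All Hilbert spaces are finite-dimensional, $\log$ is to base $2$, and a quantum operation is a completely positive trace-preserving map $\Phi(\rho)=\sum_k E_k\rho E_k^\dagger$, $\sum_k E_k^\dagger E_k=\mathsf{id}$. An $(r,m_A,m_B)$ two-party protocol $\Pi$ ($r\ge 1$) consists of input spaces $\mathcal A_0,\mathcal B_0$, memory spaces $\mathcal A_1,\dots,\mathcal A_r$ (Alice) and $\mathcal B_1,\dots,\mathcal B_r$ (Bob), message spaces $\mathcal X_1,\dots,\mathcal X_r$ (Alice to Bob) and $\mathcal Y_1,\dots,\mathcal Y_{r-1}$ (Bob to Alice), and quantum operations $\Phi_1:L(\mathcal A_0)\to L(\mathcal A_1\otimes\mathcal X_1)$, $\Phi_i:L(\mathcal A_{i-1}\otimes\mathcal Y_{i-1})\to L(\mathcal A_i\otimes\mathcal X_i)$ for $2\le i\le r$, $\Psi_j:L(\mathcal B_{j-1}\otimes\mathcal X_j)\to L(\mathcal B_j\otimes\mathcal Y_j)$ for $1\le j\le r-1$, and $\Psi_r:L(\mathcal B_{r-1}\otimes\mathcal X_r)\to L(\mathcal B_r)$, applied in the order $\Phi_1,\Psi_1,\dots,\Phi_r,\Psi_r$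 (each tensored with the identity on the other party's system); $\Pi(\rho)$ is the resulting state on $\mathcal A_r\otimes\mathcal B_r$. Its communication costs are $m_A=\sum_{i=1}^r\log\dim\mathcal X_i$ and $m_B=\sum_{j=1}^{r-1}\log\dim\mathcal Y_j$. For a state $\rho_{AB}$ let $$H_{\min}(A|B)_\rho=-\inf\{\lambda\in\mathbb R:\ \rho_{AB}\le 2^\lambda\,\mathsf{id}_A\otimes\sigma_B\text{ for some density operator }\sigma_B\}.$$ **Corollary.** Let $\rho_{A_0B_0}=\sum_a p_a|a\rangle\langle a|\otimes\rho^a_{B_0}$ be a cq-state, where $(|a\rangle)_a$ is an orthonormal basis of $\mathcal A_0$, $(p_a)_a$ is a probability distribution and the $\rho^a_{B_0}$ are density operators; Alice holds $A_0$ and Bob holds $B_0$. Let $\Pi$ be an $(r,m_A,m_B)$ protocol with input spaces $\mathcal A_0,\mathcal B_0$, and let $p\in(0,1]$. Suppose that Bob can recover $a$ with probability at least $p$, i.e. there is a measurement (POVM) $(E_a)_a$ on $\mathcal B_r$ with $$\sum_a p_a\,\mathrm{tr}\Big(E_a\,\mathrm{tr}_{A_r}\big(\Pi(|a\rangle\langle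 a|\otimes\rho^a_{B_0})\big)\Big)\ \ge\ p.$$ Then $$m_A+m_B\ \ge\ H_{\min}(A_0|B_0)_\rho-\log\frac1p\qquad\text{and}\qquad 2m_A\ \ge\ H_{\min}(A_0|B_0)_\rho-\log\frac1p .$$ -/

import Mathlib

open scoped Kronecker ComplexOrder

noncomputable section

namespace QComm

/-- A density operator on the Hilbert space with orthonormal basis indexed by `n`. -/
structure IsDensity {n : Type*} [Fintype n] (ρ : Matrix n n ℂ) : Prop where
  posSemidef : ρ.PosSemidef
  trace_eq_one : ρ.trace = 1

/-- Quantum operations: completely positive trace-preserving maps, in operator-sum form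
`Φ ρ = ∑ₖ Eₖ ρ Eₖ†` with `∑ₖ Eₖ† Eₖ = 1`. -/
def IsCPTP {m n : Type*} [Fintype m] [DecidableEq m] [Fintype n]
    (Φ : Matrix m m ℂ →ₗ[ℂ] Matrix n n ℂ) : Prop :=
  ∃ (N : ℕ) (E : Fin N → Matrix n m ℂ),
    (∑ k, (E k).conjTranspose * E k = 1) ∧ ∀ ρ, Φ ρ = ∑ k, E k * ρ * (E k).conjTranspose

/-- `Φ ⊗ id`: the map `Φ` applied to the left tensor factor (block by block). -/
def applyLeft {m n k : Type*} (Φ : Matrix m m ℂ →ₗ[ℂ] Matrix n n ℂ)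
    (ρ : Matrix (m × k) (m × k) ℂ) : Matrix (n × k) (n × k) ℂ :=
  Matrix.of fun i j => Φ (Matrix.of fun s t => ρ (s, i.2) (t, j.2)) i.1 j.1

/-- Exchange the first and the third of three tensor factors. -/
def swapOuter {a b c : Type*} (ρ : Matrix ((a × c) × b) ((a × c) × b) ℂ) :
    Matrix ((b × c) × a) ((b × c) × a) ℂ :=
  ρ.submatrix (fun q => ((q.2, q.1.2), q.1.1)) (fun q => ((q.2, q.1.2), q.1.1))

/-- Partial trace over the left tensor factor. -/
def traceLeft {a b : Type*} [Fintype a] (ρ : Matrix (a × b) (a × b) ℂ) : Matrix b b ℂ :=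
  Matrix.of fun i j => ∑ s, ρ (s, i) (s, j)

/-- The cq-state `∑ₐ pₐ |a⟩⟨a| ⊗ ρᵃ`. -/
def cqState {a b : Type*} [Fintype a] [DecidableEq a] (p : a → ℝ) (ρ : a → Matrix b b ℂ) :
    Matrix (a × b) (a × b) ℂ :=
  ∑ x, (p x : ℂ) • (Matrix.single x x (1 : ℂ) ⊗ₖ ρ x)

/-- The conditional min-entropy `H_min(A|B)_ρ`, minus the infimum of all real `l` such that
`ρ ≤ 2 ^ l • (1 ⊗ σ)` in the Loewner order for some density operator `σ` on `B`. -/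
def minEntropy {a b : Type*} [Fintype a] [DecidableEq a] [Fintype b]
    (ρ : Matrix (a × b) (a × b) ℂ) : ℝ :=
  -sInf {l : ℝ | ∃ σ : Matrix b b ℂ, IsDensity σ ∧
      (((2 : ℝ) ^ l) • ((1 : Matrix a a ℂ) ⊗ₖ σ) - ρ).PosSemidef}

/-- A measurement (POVM) with outcomes in `o`. -/
structure IsPOVM {o n : Type*} [Fintype o] [Fintype n] [DecidableEq n]
    (E : o → Matrix n n ℂ) : Prop where
  posSemidef : ∀ x, (E x).PosSemidef
  sum_eq_one : ∑ x, E x = 1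

/-- Two-party quantum protocols with `r = n + 1 ≥ 1` rounds, in which Alice sends the first and
the last message. `A 0`, `B 0` are the input spaces, `A 1, …, A r` and `B 1, …, B r` the memory
spaces, `X 1, …, X r` the messages from Alice to Bob and `Y 1, …, Y (r - 1)` the messages from
Bob to Alice (a type stands for the Hilbert space with a basis indexed by it; the entries of the
families at other indices play no role). Alice's operations are `alice₁` in round `1` and
`alice i` in round `i + 2`, Bob's are `bob i` in round `i + 1 < r` and `bobLast` in round `r`. -/
structure Protocol (n : ℕ) (A B X Y : ℕ → Type*)
    [∀ i, Fintype (A i)] [∀ i, DecidableEq (A i)] [∀ i, Fintype (B i)] [∀ i, DecidableEq (B i)]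
    [∀ i, Fintype (X i)] [∀ i, DecidableEq (X i)] [∀ i, Fintype (Y i)] [∀ i, DecidableEq (Y i)]
    where
  alice₁ : Matrix (A 0) (A 0) ℂ →ₗ[ℂ] Matrix (A 1 × X 1) (A 1 × X 1) ℂ
  alice : ∀ i, Matrix (A (i + 1) × Y (i + 1)) (A (i + 1) × Y (i + 1)) ℂ →ₗ[ℂ]
    Matrix (A (i + 2) × X (i + 2)) (A (i + 2) × X (i + 2)) ℂ
  bob : ∀ i, Matrix (B i × X (i + 1)) (B i × X (i + 1)) ℂ →ₗ[ℂ]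
    Matrix (B (i + 1) × Y (i + 1)) (B (i + 1) × Y (i + 1)) ℂ
  bobLast : Matrix (B n × X (n + 1)) (B n × X (n + 1)) ℂ →ₗ[ℂ]
    Matrix (B (n + 1)) (B (n + 1)) ℂ
  alice₁_cptp : IsCPTP alice₁
  alice_cptp : ∀ i < n, IsCPTP (alice i)
  bob_cptp : ∀ i < n, IsCPTP (bob i)
  bobLast_cptp : IsCPTP bobLast

namespace Protocol

variable {n : ℕ} {A B X Y : ℕ → Type*}
    [∀ i, Fintype (A i)] [∀ i, DecidableEq (A i)] [∀ i, Fintype (B i)] [∀ i, DecidableEq (B i)]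
    [∀ i, Fintype (X i)] [∀ i, DecidableEq (X i)] [∀ i, Fintype (Y i)] [∀ i, DecidableEq (Y i)]

/-- The state of Alice's memory, message and Bob's memory right after Alice's operation in
round `k + 1`. -/
def afterAlice (P : Protocol n A B X Y) (ρ : Matrix (A 0 × B 0) (A 0 × B 0) ℂ) :
    (k : ℕ) → Matrix ((A (k + 1) × X (k + 1)) × B k) ((A (k + 1) × X (k + 1)) × B k) ℂ
  | 0 => applyLeft P.alice₁ ρ
  | k + 1 =>
    applyLeft (P.alice k) (swapOuter (applyLeft (P.bob k) (swapOuter (P.afterAlice ρ k))))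

/-- The final state of the protocol, on Alice's and Bob's last memory spaces. -/
def final (P : Protocol n A B X Y) (ρ : Matrix (A 0 × B 0) (A 0 × B 0) ℂ) :
    Matrix (A (n + 1) × B (n + 1)) (A (n + 1) × B (n + 1)) ℂ :=
  (applyLeft P.bobLast (swapOuter (P.afterAlice ρ n))).submatrix Prod.swap Prod.swap

/-- `m_A`, the number of qubits sent from Alice to Bob: the sum of `log₂ dim X i`, `1 ≤ i ≤ r`. -/
def qubitsAlice (_ : Protocol n A B X Y) : ℝ :=
  ∑ i ∈ Finset.range (n + 1), Real.logb 2 (Fintype.card (X (i + 1)))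

/-- `m_B`, the number of qubits sent from Bob to Alice: the sum of `log₂ dim Y j`,
`1 ≤ j ≤ r - 1`. -/
def qubitsBob (_ : Protocol n A B X Y) : ℝ :=
  ∑ j ∈ Finset.range n, Real.logb 2 (Fintype.card (Y (j + 1)))

/-- The probability that Bob, measuring his part of the final state with `E`, obtains Alice's
classical value: this value is `a` with probability `p a`, and the protocol then runs on the input
`|a⟩⟨a| ⊗ ρᵃ`. -/
def successProb (P : Protocol n A B X Y) (p : A 0 → ℝ) (ρ : A 0 → Matrix (B 0) (B 0) ℂ)
    (E : A 0 → Matrix (B (n + 1)) (B (n + 1)) ℂ) : ℝ :=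
  ∑ a, p a * (E a * traceLeft (P.final (Matrix.single a a (1 : ℂ) ⊗ₖ ρ a))).trace.re

end Protocol

end QComm

end

/-!
A message `c` that crosses the cut can be simulated by postselected teleportation: the receiver
holds half of an unnormalised maximally entangled pair, and its other half is contracted with the
sender's operator. The joint operator then always stays below the contraction (`link`), over the
shared transcript, of one operator per party. A local operation acts on one of the two arguments,
and a message multiplies the trace of the receiver's operator by its dimension. If `T` dominates all
`qₐ ρᵃ`, the inputs `|a⟩⟨a| ⊗ qₐ ρᵃ` are dominated by `|a⟩⟨a| ⊗ T`, so Alice's operators reach the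
trace `∏ |Y|` and Bob's operator, which does not depend on `a`, the trace `∏ |X| · tr T`. Bounding
the transcript marginal of Alice's operator by its trace puts Bob's final states below one operator
of trace `∏ |Y| ∏ |X| tr T`, which therefore bounds his success probability. The choice
`T = 2 ^ l • σ` and the infimum over `l` give the bound on `m_A + m_B`.

For `2 m_A` it is enough to follow Bob's marginal. Sending a message does not increase the trace of
its dominating operator, and receiving `x` costs `|x| ^ 2` because `ω ≤ |x| • (tr_x ω ⊗ 1)`.
-/

namespace QComm

open Matrix
open scoped MatrixOrder

section LoewnerOrder

variable {𝕜 m n : Type*} [RCLike 𝕜]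

theorem submatrix_le_submatrix {S T : Matrix m m 𝕜} (h : S ≤ T) (f : n → m) :
    S.submatrix f f ≤ T.submatrix f f :=
  (Matrix.le_iff.mp h).submatrix f

theorem submatrix_nonneg {M : Matrix m m 𝕜} (hM : 0 ≤ M) (f : n → m) : 0 ≤ M.submatrix f f :=
  (hM.posSemidef.submatrix f).nonneg

theorem conj_le_conj [Fintype m] [Finite n] {S T : Matrix m m 𝕜} (h : S ≤ T) (M : Matrix n m 𝕜) :
    M * S * Mᴴ ≤ M * T * Mᴴ := by
  rw [Matrix.le_iff, ← Matrix.sub_mul, ← Matrix.mul_sub]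
  exact (Matrix.le_iff.mp h).mul_mul_conjTranspose_same M

theorem kronecker_nonneg [Finite m] [Finite n] {S : Matrix m m 𝕜} {T : Matrix n n 𝕜}
    (hS : 0 ≤ S) (hT : 0 ≤ T) : 0 ≤ S ⊗ₖ T :=
  (hS.posSemidef.kronecker hT.posSemidef).nonneg

theorem kronecker_le_kronecker [Finite m] [Finite n] {S S' : Matrix m m 𝕜} {T T' : Matrix n n 𝕜}
    (hS : S ≤ S') (hT : T ≤ T') (hS₀ : 0 ≤ S) (hT' : 0 ≤ T') : S ⊗ₖ T ≤ S' ⊗ₖ T' := by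
  have hsub : S' ⊗ₖ T' - S ⊗ₖ T = (S' - S) ⊗ₖ T' + S ⊗ₖ (T' - T) := by
    ext
    simp [mul_sub, sub_mul]
  rw [← sub_nonneg, hsub]
  exact add_nonneg (kronecker_nonneg (sub_nonneg.mpr hS) hT')
    (kronecker_nonneg hS₀ (sub_nonneg.mpr hT))

theorem single_nonneg [Finite n] [DecidableEq n] (i : n) : 0 ≤ Matrix.single i i (1 : 𝕜) := by
  have hsingle : vecMulVec (Pi.single i 1) (star (Pi.single i 1)) = Matrix.single i i (1 : 𝕜) := by
    rw [← Pi.single_star, star_one, Matrix.single_eq_single_vecMulVec_single]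
  exact hsingle ▸ (posSemidef_vecMulVec_self_star _).nonneg

theorem trace_submatrix_equiv [Fintype m] [Fintype n] (M : Matrix m m 𝕜) (e : n ≃ m) :
    (M.submatrix e e).trace = M.trace :=
  e.sum_comp fun i => M i i

theorem le_trace_smul_one [Fintype n] [DecidableEq n] {M : Matrix n n 𝕜} (hM : 0 ≤ M) :
    M ≤ M.trace • 1 := by
  have hherm := hM.posSemidef.isHermitian
  have hspec : ∀ x ∈ spectrum ℝ M, x ≤ ∑ i, hherm.eigenvalues i := by
    rw [hherm.spectrum_real_eq_range_eigenvalues]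
    rintro _ ⟨i, rfl⟩
    exact Finset.single_le_sum (fun j _ => hM.posSemidef.eigenvalues_nonneg j) (Finset.mem_univ i)
  have htrace : M.trace • (1 : Matrix n n 𝕜) =
      algebraMap ℝ (Matrix n n 𝕜) (∑ i, hherm.eigenvalues i) := by
    rw [hherm.trace_eq_sum_eigenvalues, Algebra.algebraMap_eq_smul_one, ← RCLike.ofReal_sum,
      RCLike.real_smul_eq_coe_smul (K := 𝕜)]
  exact htrace ▸ le_algebraMap_of_spectrum_le hspec hherm

theorem trace_mul_nonneg [Fintype n] {S T : Matrix n n 𝕜} (hS : 0 ≤ S) (hT : 0 ≤ T) :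
    0 ≤ (S * T).trace := by
  classical
  obtain ⟨M, rfl⟩ := CStarAlgebra.nonneg_iff_eq_star_mul_self.mp hS
  rw [star_eq_conjTranspose, Matrix.mul_assoc, trace_mul_comm]
  exact (hT.posSemidef.mul_mul_conjTranspose_same M).trace_nonneg

end LoewnerOrder

section PartialTrace

variable {a b c : Type*}

/-- Partial trace over the right tensor factor. -/
def traceRight [Fintype b] (ρ : Matrix (a × b) (a × b) ℂ) : Matrix a a ℂ :=
  Matrix.of fun i j => ∑ s, ρ (i, s) (j, s)

theorem traceRight_le_traceRight [Fintype b] {S T : Matrix (a × b) (a × b) ℂ} (h : S ≤ T) :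
    traceRight S ≤ traceRight T := by
  have hsum (M : Matrix (a × b) (a × b) ℂ) :
      traceRight M = ∑ s, M.submatrix (·, s) (·, s) := by
    ext
    simp [traceRight, Matrix.sum_apply]
  rw [hsum, hsum]
  exact Finset.sum_le_sum fun s _ => submatrix_le_submatrix h (·, s)

theorem traceRight_nonneg [Fintype b] {M : Matrix (a × b) (a × b) ℂ} (hM : 0 ≤ M) :
    0 ≤ traceRight M := by
  have hzero : traceRight (0 : Matrix (a × b) (a × b) ℂ) = 0 := by
    ext
    simp [traceRight]
  simpa only [hzero] using traceRight_le_traceRight hM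

theorem traceLeft_nonneg [Fintype a] {M : Matrix (a × b) (a × b) ℂ} (hM : 0 ≤ M) :
    0 ≤ traceLeft M := by
  have hswap : traceRight (M.submatrix Prod.swap Prod.swap) = traceLeft M := rfl
  rw [← hswap]
  exact traceRight_nonneg (submatrix_nonneg hM Prod.swap)

theorem trace_traceRight [Fintype a] [Fintype b] (M : Matrix (a × b) (a × b) ℂ) :
    (traceRight M).trace = M.trace := by
  simp [traceRight, Matrix.trace, Fintype.sum_prod_type]

theorem trace_traceLeft [Fintype a] [Fintype b] (M : Matrix (a × b) (a × b) ℂ) :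
    (traceLeft M).trace = M.trace := by
  simp [traceLeft, Matrix.trace, Fintype.sum_prod_type_right]

theorem traceLeft_submatrix_swap [Fintype b] (M : Matrix (a × b) (a × b) ℂ) :
    traceLeft (M.submatrix Prod.swap Prod.swap) = traceRight M :=
  rfl

theorem traceLeft_kronecker [Fintype a] (S : Matrix a a ℂ) (T : Matrix b b ℂ) :
    traceLeft (S ⊗ₖ T) = S.trace • T := by
  ext
  simp [traceLeft, Matrix.trace, Finset.sum_mul]

theorem swapOuter_swapOuter (M : Matrix ((a × c) × b) ((a × c) × b) ℂ) :
    swapOuter (swapOuter M) = M :=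
  rfl

theorem swapOuter_le_swapOuter {S T : Matrix ((a × c) × b) ((a × c) × b) ℂ} (h : S ≤ T) :
    swapOuter S ≤ swapOuter T :=
  submatrix_le_submatrix h _

theorem swapOuter_nonneg {M : Matrix ((a × c) × b) ((a × c) × b) ℂ} (hM : 0 ≤ M) :
    0 ≤ swapOuter M :=
  submatrix_nonneg hM _

theorem traceLeft_swapOuter [Fintype b] [Fintype c] (M : Matrix ((a × c) × b) ((a × c) × b) ℂ) :
    traceLeft (swapOuter M) = traceRight (traceRight M) := by
  ext
  simp [traceLeft, swapOuter, traceRight, Fintype.sum_prod_type_right]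

end PartialTrace

section Channel

variable {k m n : Type*} {Φ : Matrix m m ℂ →ₗ[ℂ] Matrix n n ℂ}

theorem applyLeft_smul (c : ℂ) (M : Matrix (m × k) (m × k) ℂ) :
    applyLeft Φ (c • M) = c • applyLeft Φ M := by
  ext i j
  exact congr_fun₂ (map_smul Φ c (Matrix.of fun s t => M (s, i.2) (t, j.2))) i.1 j.1

theorem traceRight_applyLeft [Fintype k] (M : Matrix (m × k) (m × k) ℂ) :
    traceRight (applyLeft Φ M) = Φ (traceRight M) := by
  have hsum : traceRight M = ∑ s, Matrix.of fun i j => M (i, s) (j, s) := by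
    ext
    simp [traceRight, Matrix.sum_apply]
  rw [hsum, map_sum]
  ext
  simp [traceRight, applyLeft, Matrix.sum_apply]

variable [Fintype m] [DecidableEq m] [Fintype n]

theorem IsCPTP.map_le_map (hΦ : IsCPTP Φ) {S T : Matrix m m ℂ} (h : S ≤ T) : Φ S ≤ Φ T := by
  obtain ⟨N, E, -, hE⟩ := hΦ
  rw [hE, hE]
  exact Finset.sum_le_sum fun l _ => conj_le_conj h (E l)

theorem IsCPTP.trace_map (hΦ : IsCPTP Φ) (M : Matrix m m ℂ) : (Φ M).trace = M.trace := by
  obtain ⟨N, E, hone, hE⟩ := hΦ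
  have hcycle (l : Fin N) : (E l * M * (E l)ᴴ).trace = ((E l)ᴴ * E l * M).trace := by
    rw [Matrix.trace_mul_comm, Matrix.mul_assoc]
  simp only [hE, Matrix.trace_sum, hcycle]
  rw [← Matrix.trace_sum, ← Matrix.sum_mul, hone, Matrix.one_mul]

theorem traceLeft_applyLeft (hΦ : IsCPTP Φ) (M : Matrix (m × k) (m × k) ℂ) :
    traceLeft (applyLeft Φ M) = traceLeft M := by
  ext i j
  exact hΦ.trace_map (Matrix.of fun s t => M (s, i) (t, j))

theorem trace_applyLeft [Fintype k] (hΦ : IsCPTP Φ) (M : Matrix (m × k) (m × k) ℂ) :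
    (applyLeft Φ M).trace = M.trace := by
  rw [← trace_traceLeft, traceLeft_applyLeft hΦ, trace_traceLeft]

theorem applyLeft_le_applyLeft [Finite k] (hΦ : IsCPTP Φ) {S T : Matrix (m × k) (m × k) ℂ}
    (h : S ≤ T) : applyLeft Φ S ≤ applyLeft Φ T := by
  classical
  have := Fintype.ofFinite k
  obtain ⟨N, E, -, hE⟩ := hΦ
  have hkraus (M : Matrix (m × k) (m × k) ℂ) : applyLeft Φ M =
      ∑ l, (E l ⊗ₖ (1 : Matrix k k ℂ)) * M * (E l ⊗ₖ (1 : Matrix k k ℂ))ᴴ := by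
    ext
    simp [applyLeft, hE, Matrix.mul_apply, Matrix.sum_apply, Fintype.sum_prod_type,
      Matrix.one_apply, Finset.sum_mul, apply_ite (starRingEnd ℂ)]
  rw [hkraus, hkraus]
  exact Finset.sum_le_sum fun l _ => conj_le_conj h _

theorem applyLeft_nonneg [Finite k] (hΦ : IsCPTP Φ) {M : Matrix (m × k) (m × k) ℂ}
    (h : 0 ≤ M) : 0 ≤ applyLeft Φ M := by
  have hzero : applyLeft Φ (0 : Matrix (m × k) (m × k) ℂ) = 0 := by
    simpa using applyLeft_smul (Φ := Φ) 0 0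
  simpa only [hzero] using applyLeft_le_applyLeft hΦ h

end Channel

section Link

variable {a b c u v : Type*} [Fintype u]

/-- The link of an operator on `a ⊗ u` with one on `b ⊗ u`: the pairing of the two factors `u`,
which carry the transcript shared by two parties. The pairing is entrywise, without a transpose of
either argument, so that linking with `maxEntangled u` is the identity. -/
def link (τ : Matrix (a × u) (a × u) ℂ) (σ : Matrix (b × u) (b × u) ℂ) :
    Matrix (a × b) (a × b) ℂ :=
  Matrix.of fun i j => ∑ s, ∑ t, τ (i.1, s) (j.1, t) * σ (i.2, s) (j.2, t)

/-- The unnormalised maximally entangled operator `∑ᵢⱼ |ii⟩⟨jj|` on `c ⊗ c`. -/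
def maxEntangled (c : Type*) [DecidableEq c] : Matrix (c × c) (c × c) ℂ :=
  Matrix.of fun i j => if i.1 = i.2 ∧ j.1 = j.2 then 1 else 0

theorem maxEntangled_nonneg [Finite c] [DecidableEq c] : 0 ≤ maxEntangled c := by
  let Ω : c × c → ℂ := fun p => if p.1 = p.2 then 1 else 0
  have hΩ : maxEntangled c = vecMulVec Ω (star Ω) := by
    ext i j
    by_cases hi : i.1 = i.2 <;> by_cases hj : j.1 = j.2 <;>
      simp [maxEntangled, Ω, vecMulVec_apply, hi, hj]
  exact hΩ ▸ (posSemidef_vecMulVec_self_star Ω).nonneg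

theorem trace_maxEntangled [Fintype c] [DecidableEq c] :
    (maxEntangled c).trace = Fintype.card c := by
  simp only [maxEntangled, Matrix.trace, Matrix.diag_apply, Matrix.of_apply, and_self,
    Fintype.sum_prod_type, Finset.sum_ite_eq, Finset.mem_univ, if_true, Finset.sum_const,
    Finset.card_univ, nsmul_eq_mul, mul_one]

theorem link_nonneg [Finite a] [Finite b] {τ : Matrix (a × u) (a × u) ℂ}
    {σ : Matrix (b × u) (b × u) ℂ} (hτ : 0 ≤ τ) (hσ : 0 ≤ σ) : 0 ≤ link τ σ := by
  classical
  have := Fintype.ofFinite a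
  have := Fintype.ofFinite b
  let K : Matrix ((a × b) × u) ((a × b) × u) ℂ :=
    (τ ⊗ₖ σ).submatrix (fun p => ((p.1.1, p.2), (p.1.2, p.2)))
      (fun p => ((p.1.1, p.2), (p.1.2, p.2)))
  let J : Matrix (a × b) ((a × b) × u) ℂ := Matrix.of fun i p => if i = p.1 then 1 else 0
  have hK : 0 ≤ K := submatrix_nonneg (kronecker_nonneg hτ hσ) _
  have hlink : link τ σ = J * K * Jᴴ := by
    ext i j
    simp only [link, J, K, Matrix.of_apply, Matrix.mul_apply, submatrix_apply,
      kroneckerMap_apply, conjTranspose_apply, RCLike.star_def, MonoidWithZeroHom.map_ite_one_zero,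
      ite_mul, mul_ite, one_mul, mul_one, zero_mul, mul_zero, Fintype.sum_prod_type_right,
      Finset.sum_ite_eq, Finset.mem_univ, if_true]
    exact Finset.sum_comm
  rw [hlink]
  simpa using conj_le_conj hK J

theorem link_le_link_right [Finite a] [Finite b] {τ : Matrix (a × u) (a × u) ℂ} (hτ : 0 ≤ τ)
    {σ σ' : Matrix (b × u) (b × u) ℂ} (h : σ ≤ σ') : link τ σ ≤ link τ σ' := by
  have hsub : link τ σ' - link τ σ = link τ (σ' - σ) := by
    ext
    simp [link, mul_sub]
  rw [← sub_nonneg, hsub]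
  exact link_nonneg hτ (sub_nonneg.mpr h)

theorem link_maxEntangled [DecidableEq u] (τ : Matrix (a × u) (a × u) ℂ) :
    link τ (maxEntangled u) = τ := by
  ext
  simp [link, maxEntangled, ite_and]

theorem link_one [DecidableEq b] [DecidableEq u] (τ : Matrix (a × u) (a × u) ℂ) :
    link τ (1 : Matrix (b × u) (b × u) ℂ) = traceRight τ ⊗ₖ 1 := by
  ext
  simp [link, traceRight, Matrix.one_apply, ite_and]

theorem link_smul (τ : Matrix (a × u) (a × u) ℂ) (z : ℂ) (σ : Matrix (b × u) (b × u) ℂ) :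
    link τ (z • σ) = z • link τ σ := by
  ext
  simp [link, Finset.mul_sum, mul_left_comm]

theorem le_card_smul_traceRight_kronecker_one [Finite a] [DecidableEq u]
    {ω : Matrix (a × u) (a × u) ℂ} (hω : 0 ≤ ω) :
    ω ≤ (Fintype.card u : ℂ) • (traceRight ω ⊗ₖ (1 : Matrix u u ℂ)) :=
  calc ω = link ω (maxEntangled u) := (link_maxEntangled ω).symm
    _ ≤ link ω ((maxEntangled u).trace • 1) :=
      link_le_link_right hω (le_trace_smul_one maxEntangled_nonneg)
    _ = (Fintype.card u : ℂ) • (traceRight ω ⊗ₖ 1) := by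
      rw [link_smul, link_one, trace_maxEntangled]

theorem traceRight_link [Fintype b] (τ : Matrix (a × u) (a × u) ℂ)
    (σ : Matrix (b × u) (b × u) ℂ) : traceRight (link τ σ) =
      traceRight (link τ ((traceLeft σ).submatrix (Prod.snd : Unit × u → u) Prod.snd)) := by
  ext
  simp only [traceRight, link, traceLeft, Matrix.of_apply, Matrix.submatrix_apply,
    Finset.univ_unique, Finset.sum_singleton, Finset.mul_sum]
  rw [Finset.sum_comm]
  exact Finset.sum_congr rfl fun _ _ => Finset.sum_comm

theorem traceRight_link_le [Finite a] [Fintype b] {τ : Matrix (a × u) (a × u) ℂ} (hτ : 0 ≤ τ)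
    {σ : Matrix (b × u) (b × u) ℂ} (hσ : 0 ≤ σ) :
    traceRight (link τ σ) ≤ σ.trace • traceRight τ := by
  classical
  have hmarginal : traceLeft σ ≤ σ.trace • 1 :=
    trace_traceLeft σ ▸ le_trace_smul_one (traceLeft_nonneg hσ)
  calc traceRight (link τ σ)
      = traceRight (link τ ((traceLeft σ).submatrix (Prod.snd : Unit × u → u) Prod.snd)) :=
        traceRight_link τ σ
    _ ≤ traceRight (link τ
          ((σ.trace • (1 : Matrix u u ℂ)).submatrix (Prod.snd : Unit × u → u) Prod.snd)) :=
        traceRight_le_traceRight (link_le_link_right hτ (submatrix_le_submatrix hmarginal _))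
    _ = σ.trace • traceRight τ := by
        ext
        simp [traceRight, link, Matrix.one_apply, Finset.mul_sum, mul_comm]

theorem applyLeft_link {m n : Type*} (Φ : Matrix m m ℂ →ₗ[ℂ] Matrix n n ℂ)
    (τ : Matrix (m × u) (m × u) ℂ) (σ : Matrix (b × u) (b × u) ℂ) :
    applyLeft Φ (link τ σ) = link (applyLeft Φ τ) σ := by
  ext i j
  have hblock : (Matrix.of fun s t => link τ σ (s, i.2) (t, j.2)) =
      ∑ p, ∑ q, σ (i.2, p) (j.2, q) • Matrix.of fun s t => τ (s, p) (t, q) := by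
    ext
    simp [link, Matrix.sum_apply, mul_comm]
  simp only [applyLeft, Matrix.of_apply, hblock, map_sum, map_smul]
  simp [link, Matrix.sum_apply, mul_comm]

theorem kronecker_eq_link (S : Matrix a a ℂ) (T : Matrix b b ℂ) :
    S ⊗ₖ T = link (S.submatrix (Equiv.prodUnique a Unit) (Equiv.prodUnique a Unit))
      (T.submatrix (Equiv.prodUnique b Unit) (Equiv.prodUnique b Unit)) := by
  ext
  simp [link]

theorem link_submatrix_equiv [Fintype v] (e : v ≃ u) (τ : Matrix (a × u) (a × u) ℂ)
    (σ : Matrix (b × u) (b × u) ℂ) :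
    link (τ.submatrix ((Equiv.refl a).prodCongr e) ((Equiv.refl a).prodCongr e))
      (σ.submatrix ((Equiv.refl b).prodCongr e) ((Equiv.refl b).prodCongr e)) = link τ σ := by
  ext i j
  simp only [link, Matrix.of_apply, Matrix.submatrix_apply, Equiv.prodCongr_apply,
    Equiv.coe_refl, Prod.map, id]
  rw [← e.sum_comp]
  exact Finset.sum_congr rfl fun s _ =>
    e.sum_comp fun t => τ (i.1, e s) (j.1, t) * σ (i.2, e s) (j.2, t)

end Link

section Message

variable {a b c u : Type*}

/-- The operator of a party on `a ⊗ u` after sending the message `c` of its system `a ⊗ c`: the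
message becomes part of the transcript. -/
def sendMessage (τ : Matrix ((a × c) × u) ((a × c) × u) ℂ) :
    Matrix (a × (c × u)) (a × (c × u)) ℂ :=
  τ.submatrix (Equiv.prodAssoc a c u).symm (Equiv.prodAssoc a c u).symm

/-- The operator of a party on `b ⊗ u` after receiving the message `c`: half of an unnormalised
maximally entangled pair joins its system, and linking the other half with the sender's operator
teleports the message. -/
def receiveMessage (c : Type*) [DecidableEq c] (σ : Matrix (b × u) (b × u) ℂ) :
    Matrix ((b × c) × (c × u)) ((b × c) × (c × u)) ℂ :=
  (σ ⊗ₖ maxEntangled c).submatrix (fun p => ((p.1.1, p.2.2), (p.1.2, p.2.1)))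
    (fun p => ((p.1.1, p.2.2), (p.1.2, p.2.1)))

theorem sendMessage_nonneg {τ : Matrix ((a × c) × u) ((a × c) × u) ℂ} (hτ : 0 ≤ τ) :
    0 ≤ sendMessage τ :=
  submatrix_nonneg hτ _

theorem receiveMessage_nonneg [Finite b] [Finite c] [Finite u] [DecidableEq c]
    {σ : Matrix (b × u) (b × u) ℂ} (hσ : 0 ≤ σ) : 0 ≤ receiveMessage c σ :=
  submatrix_nonneg (kronecker_nonneg hσ maxEntangled_nonneg) _

variable [Fintype c] [Fintype u]

theorem trace_sendMessage [Fintype a] (τ : Matrix ((a × c) × u) ((a × c) × u) ℂ) :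
    (sendMessage τ).trace = τ.trace :=
  trace_submatrix_equiv τ _

variable [DecidableEq c]

theorem trace_receiveMessage [Fintype b] (σ : Matrix (b × u) (b × u) ℂ) :
    (receiveMessage c σ).trace = Fintype.card c * σ.trace := by
  simp [receiveMessage, maxEntangled, Matrix.trace, Fintype.sum_prod_type, Finset.mul_sum]

theorem swapOuter_link (τ : Matrix ((a × c) × u) ((a × c) × u) ℂ)
    (σ : Matrix (b × u) (b × u) ℂ) :
    swapOuter (link τ σ) = link (receiveMessage c σ) (sendMessage τ) := by
  ext i j
  simp only [swapOuter, link, receiveMessage, sendMessage, maxEntangled, Fintype.sum_prod_type,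
    ite_and, Matrix.of_apply, Matrix.submatrix_apply, kroneckerMap_apply,
    Equiv.prodAssoc_symm_apply, ite_mul, one_mul, zero_mul,
    Finset.sum_ite_irrel, Finset.sum_const_zero, Finset.sum_ite_eq, Finset.mem_univ, if_true,
    mul_comm]

theorem applyLeft_swapOuter_le_link {b' : Type*} [Finite a] [Fintype b] [DecidableEq b] [Fintype b']
    {Ψ : Matrix (b × c) (b × c) ℂ →ₗ[ℂ] Matrix b' b' ℂ} (hΨ : IsCPTP Ψ)
    {ω : Matrix ((a × c) × b) ((a × c) × b) ℂ} {τ : Matrix ((a × c) × u) ((a × c) × u) ℂ}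
    {S : Matrix (b × u) (b × u) ℂ} (h : ω ≤ link τ S) :
    applyLeft Ψ (swapOuter ω) ≤ link (applyLeft Ψ (receiveMessage c S)) (sendMessage τ) := by
  rw [← applyLeft_link, ← swapOuter_link]
  exact applyLeft_le_applyLeft hΨ (swapOuter_le_swapOuter h)

end Message

section CommonBound

variable {ι n : Type*} [Fintype n]

/-- All operators of the family `ω` lie below a single operator of trace `t`. -/
def HasCommonBound (ω : ι → Matrix n n ℂ) (t : ℂ) : Prop :=
  ∃ S : Matrix n n ℂ, S.trace = t ∧ ∀ i, ω i ≤ S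

theorem HasCommonBound.map {m : Type*} [Fintype m] [DecidableEq n] {ω : ι → Matrix n n ℂ} {t : ℂ}
    (h : HasCommonBound ω t) {Φ : Matrix n n ℂ →ₗ[ℂ] Matrix m m ℂ} (hΦ : IsCPTP Φ) :
    HasCommonBound (fun i => Φ (ω i)) t := by
  obtain ⟨S, hS, hle⟩ := h
  exact ⟨Φ S, (hΦ.trace_map S).trans hS, fun i => hΦ.map_le_map (hle i)⟩

theorem HasCommonBound.map_traceRight {b : Type*} [Fintype b]
    {ω : ι → Matrix (n × b) (n × b) ℂ} {t : ℂ} (h : HasCommonBound ω t) :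
    HasCommonBound (fun i => traceRight (ω i)) t := by
  obtain ⟨S, hS, hle⟩ := h
  exact ⟨traceRight S, (trace_traceRight S).trans hS,
    fun i => traceRight_le_traceRight (hle i)⟩

theorem HasCommonBound.sum_trace_mul_re_le [Fintype ι] [DecidableEq n] {ω E : ι → Matrix n n ℂ}
    {t : ℂ} (h : HasCommonBound ω t) (hE : IsPOVM E) : ∑ i, (E i * ω i).trace.re ≤ t.re := by
  obtain ⟨S, rfl, hle⟩ := h
  have hterm (i : ι) : (E i * ω i).trace.re ≤ (E i * S).trace.re := by
    have hgap := trace_mul_nonneg (hE.posSemidef i).nonneg (sub_nonneg.mpr (hle i))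
    rw [Matrix.mul_sub, Matrix.trace_sub, sub_nonneg] at hgap
    exact (Complex.le_def.mp hgap).1
  calc ∑ i, (E i * ω i).trace.re ≤ ∑ i, (E i * S).trace.re := Finset.sum_le_sum fun i _ => hterm i
    _ = S.trace.re := by
      rw [← Complex.re_sum, ← Matrix.trace_sum, ← Matrix.sum_mul, hE.sum_eq_one, Matrix.one_mul]

theorem HasCommonBound.traceRight_swapOuter {a b x : Type*} [Fintype a] [Fintype b] [Fintype x]
    {ω : ι → Matrix ((a × x) × b) ((a × x) × b) ℂ} {t : ℂ} (hω : ∀ i, 0 ≤ ω i)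
    (h : HasCommonBound (fun i => traceLeft (ω i)) t) :
    HasCommonBound (fun i => traceRight (swapOuter (ω i))) (Fintype.card x ^ 2 * t) := by
  classical
  obtain ⟨S, rfl, hle⟩ := h
  refine ⟨(Fintype.card x : ℂ) • (S ⊗ₖ 1), ?_, fun i => ?_⟩
  · rw [trace_smul, trace_kronecker, trace_one, smul_eq_mul]
    ring
  have hpos : 0 ≤ traceRight (swapOuter (ω i)) := traceRight_nonneg (swapOuter_nonneg (hω i))
  have hmarginal : traceRight (traceRight (swapOuter (ω i))) ≤ S := by
    rw [← traceLeft_swapOuter, swapOuter_swapOuter]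
    exact hle i
  calc traceRight (swapOuter (ω i))
      ≤ (Fintype.card x : ℂ) • (traceRight (traceRight (swapOuter (ω i))) ⊗ₖ 1) :=
        le_card_smul_traceRight_kronecker_one hpos
    _ ≤ (Fintype.card x : ℂ) • (S ⊗ₖ 1) :=
        smul_le_smul_of_nonneg_left (kronecker_le_kronecker hmarginal le_rfl
          (traceRight_nonneg hpos) zero_le_one) (Nat.cast_nonneg _)

end CommonBound

section LinkDomination

variable {ι a b : Type*} [Fintype a] [Fintype b]

/-- The operators `ω i` on `a ⊗ b` lie below links of operators of trace `s`, describing the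
first party, with one operator of trace `t` independent of `i`, describing the second party. The
transcript space is given the basis `Fin N` to avoid quantifying over types. -/
def IsLinkDominated (ω : ι → Matrix (a × b) (a × b) ℂ) (s t : ℂ) : Prop :=
  ∃ (N : ℕ) (τ : ι → Matrix (a × Fin N) (a × Fin N) ℂ) (S : Matrix (b × Fin N) (b × Fin N) ℂ),
    (∀ i, 0 ≤ τ i ∧ (τ i).trace = s ∧ ω i ≤ link (τ i) S) ∧ 0 ≤ S ∧ S.trace = t

variable {ω : ι → Matrix (a × b) (a × b) ℂ} {s t : ℂ}

theorem IsLinkDominated.of_fintype {u : Type*} [Fintype u] {τ : ι → Matrix (a × u) (a × u) ℂ}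
    {S : Matrix (b × u) (b × u) ℂ} (hτ : ∀ i, 0 ≤ τ i) (hτs : ∀ i, (τ i).trace = s) (hS : 0 ≤ S)
    (hSt : S.trace = t) (h : ∀ i, ω i ≤ link (τ i) S) : IsLinkDominated ω s t := by
  let e : Fin (Fintype.card u) ≃ u := (Fintype.equivFin u).symm
  let ea := (Equiv.refl a).prodCongr e
  let eb := (Equiv.refl b).prodCongr e
  refine ⟨_, fun i => (τ i).submatrix ea ea, S.submatrix eb eb, fun i => ⟨?_, ?_, ?_⟩, ?_, ?_⟩
  · exact submatrix_nonneg (hτ i) ea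
  · rw [trace_submatrix_equiv, hτs]
  · exact (h i).trans_eq (link_submatrix_equiv e (τ i) S).symm
  · exact submatrix_nonneg hS eb
  · rw [trace_submatrix_equiv, hSt]

theorem IsLinkDominated.of_le_kronecker {σ : ι → Matrix a a ℂ} {T : Matrix b b ℂ}
    (hσ : ∀ i, 0 ≤ σ i) (hσs : ∀ i, (σ i).trace = s) (hT : 0 ≤ T) (h : ∀ i, ω i ≤ σ i ⊗ₖ T) :
    IsLinkDominated ω s T.trace := by
  let ea := Equiv.prodUnique a Unit
  let eb := Equiv.prodUnique b Unit
  refine .of_fintype (τ := fun i => (σ i).submatrix ea ea) (S := T.submatrix eb eb)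
    (fun i => submatrix_nonneg (hσ i) ea) (fun i => ?_) (submatrix_nonneg hT eb) ?_
    (fun i => (h i).trans_eq (kronecker_eq_link (σ i) T))
  · rw [trace_submatrix_equiv, hσs]
  · rw [trace_submatrix_equiv]

theorem IsLinkDominated.map_applyLeft {a' : Type*} [Fintype a'] [DecidableEq a]
    {Φ : Matrix a a ℂ →ₗ[ℂ] Matrix a' a' ℂ} (hΦ : IsCPTP Φ) (h : IsLinkDominated ω s t) :
    IsLinkDominated (fun i => applyLeft Φ (ω i)) s t := by
  obtain ⟨N, τ, S, hτ, hS, hSt⟩ := h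
  refine ⟨N, fun i => applyLeft Φ (τ i), S, fun i => ?_, hS, hSt⟩
  obtain ⟨hτ, hτs, hle⟩ := hτ i
  refine ⟨applyLeft_nonneg hΦ hτ, (trace_applyLeft hΦ _).trans hτs, ?_⟩
  exact applyLeft_link Φ (τ i) S ▸ applyLeft_le_applyLeft hΦ hle

variable {b' x : Type*} [Fintype b'] [Fintype x] [DecidableEq b] [DecidableEq x]

variable {ω : ι → Matrix ((a × x) × b) ((a × x) × b) ℂ}

theorem IsLinkDominated.swapOuter_applyLeft_swapOuter {y : Type*} [Fintype y]
    {Ψ : Matrix (b × x) (b × x) ℂ →ₗ[ℂ] Matrix (b' × y) (b' × y) ℂ} (hΨ : IsCPTP Ψ)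
    (h : IsLinkDominated ω s t) :
    IsLinkDominated (fun i => swapOuter (applyLeft Ψ (swapOuter (ω i))))
      (Fintype.card y * s) (Fintype.card x * t) := by
  classical
  obtain ⟨N, τ, S, hτ, hS, hSt⟩ := h
  refine .of_fintype (τ := fun i => receiveMessage y (sendMessage (τ i)))
    (S := sendMessage (applyLeft Ψ (receiveMessage x S))) (fun i => ?_) (fun i => ?_) ?_ ?_
    fun i => ?_
  · exact receiveMessage_nonneg (sendMessage_nonneg (hτ i).1)
  · rw [trace_receiveMessage, trace_sendMessage, (hτ i).2.1]
  · exact sendMessage_nonneg (applyLeft_nonneg hΨ (receiveMessage_nonneg hS))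
  · rw [trace_sendMessage, trace_applyLeft hΨ, trace_receiveMessage, hSt]
  · rw [← swapOuter_link]
    exact swapOuter_le_swapOuter (applyLeft_swapOuter_le_link hΨ (hτ i).2.2)

theorem IsLinkDominated.hasCommonBound_traceRight_applyLeft_swapOuter
    {Ψ : Matrix (b × x) (b × x) ℂ →ₗ[ℂ] Matrix b' b' ℂ} (hΨ : IsCPTP Ψ)
    (h : IsLinkDominated ω s t) :
    HasCommonBound (fun i => traceRight (applyLeft Ψ (swapOuter (ω i))))
      (s * (Fintype.card x * t)) := by
  obtain ⟨N, τ, S, hτ, hS, hSt⟩ := h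
  refine ⟨s • traceRight (applyLeft Ψ (receiveMessage x S)), ?_, fun i => ?_⟩
  · rw [trace_smul, trace_traceRight, trace_applyLeft hΨ, trace_receiveMessage, hSt, smul_eq_mul]
  obtain ⟨hτi, hτis, hle⟩ := hτ i
  calc traceRight (applyLeft Ψ (swapOuter (ω i)))
      ≤ traceRight (link (applyLeft Ψ (receiveMessage x S)) (sendMessage (τ i))) :=
        traceRight_le_traceRight (applyLeft_swapOuter_le_link hΨ hle)
    _ ≤ (sendMessage (τ i)).trace • traceRight (applyLeft Ψ (receiveMessage x S)) :=
        traceRight_link_le (applyLeft_nonneg hΨ (receiveMessage_nonneg hS))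
          (sendMessage_nonneg hτi)
    _ = s • traceRight (applyLeft Ψ (receiveMessage x S)) := by rw [trace_sendMessage, hτis]

end LinkDomination

namespace Protocol

variable {n : ℕ} {A B X Y : ℕ → Type*}
    [∀ i, Fintype (A i)] [∀ i, DecidableEq (A i)] [∀ i, Fintype (B i)] [∀ i, DecidableEq (B i)]
    [∀ i, Fintype (X i)] [∀ i, DecidableEq (X i)] [∀ i, Fintype (Y i)] [∀ i, DecidableEq (Y i)]
    (P : Protocol n A B X Y)

theorem afterAlice_smul (z : ℂ) (ρ : Matrix (A 0 × B 0) (A 0 × B 0) ℂ) (k : ℕ) :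
    P.afterAlice (z • ρ) k = z • P.afterAlice ρ k := by
  induction k with
  | zero => exact applyLeft_smul z ρ
  | succ k ih =>
    simp only [afterAlice, ih, swapOuter, submatrix_smul, Pi.smul_apply, applyLeft_smul]

theorem traceLeft_final (ρ : Matrix (A 0 × B 0) (A 0 × B 0) ℂ) :
    traceLeft (P.final ρ) = traceRight (applyLeft P.bobLast (swapOuter (P.afterAlice ρ n))) :=
  traceLeft_submatrix_swap _

theorem traceLeft_final_smul (z : ℂ) (ρ : Matrix (A 0 × B 0) (A 0 × B 0) ℂ) :
    traceLeft (P.final (z • ρ)) = z • traceLeft (P.final ρ) := by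
  ext
  simp [traceLeft, final, afterAlice_smul, swapOuter, submatrix_smul, applyLeft_smul,
    Finset.mul_sum]

theorem afterAlice_nonneg {ρ : Matrix (A 0 × B 0) (A 0 × B 0) ℂ} (hρ : 0 ≤ ρ) {k : ℕ}
    (hk : k ≤ n) : 0 ≤ P.afterAlice ρ k := by
  induction k with
  | zero => exact applyLeft_nonneg P.alice₁_cptp hρ
  | succ k ih =>
    have hbob := applyLeft_nonneg (P.bob_cptp k hk)
      (swapOuter_nonneg (ih (Nat.le_of_succ_le hk)))
    exact applyLeft_nonneg (P.alice_cptp k hk) (swapOuter_nonneg hbob)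

variable {ι : Type*} {ρ : ι → Matrix (A 0 × B 0) (A 0 × B 0) ℂ} {s t : ℂ}

theorem isLinkDominated_afterAlice (h : IsLinkDominated ρ s t) {k : ℕ} (hk : k ≤ n) :
    IsLinkDominated (fun i => P.afterAlice (ρ i) k)
      ((∏ j ∈ Finset.range k, (Fintype.card (Y (j + 1)) : ℂ)) * s)
      ((∏ j ∈ Finset.range k, (Fintype.card (X (j + 1)) : ℂ)) * t) := by
  induction k with
  | zero => simpa [afterAlice] using h.map_applyLeft P.alice₁_cptp
  | succ k ih =>
    have hbob := (ih (Nat.le_of_succ_le hk)).swapOuter_applyLeft_swapOuter (P.bob_cptp k hk)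
    simp only [Finset.prod_range_succ_comm, mul_assoc]
    exact hbob.map_applyLeft (P.alice_cptp k hk)

theorem hasCommonBound_traceLeft_afterAlice (hρ : ∀ i, 0 ≤ ρ i)
    (h : HasCommonBound (fun i => traceLeft (ρ i)) t) {k : ℕ} (hk : k ≤ n) :
    HasCommonBound (fun i => traceLeft (P.afterAlice (ρ i) k))
      ((∏ j ∈ Finset.range k, (Fintype.card (X (j + 1)) : ℂ)) ^ 2 * t) := by
  induction k with
  | zero => simpa [afterAlice, traceLeft_applyLeft P.alice₁_cptp] using h
  | succ k ih =>
    have hnonneg (i : ι) := P.afterAlice_nonneg (hρ i) (Nat.le_of_succ_le hk)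
    have hbob := ((ih (Nat.le_of_succ_le hk)).traceRight_swapOuter hnonneg).map (P.bob_cptp k hk)
    simp only [afterAlice, traceLeft_applyLeft (P.alice_cptp k hk), traceLeft_swapOuter,
      traceRight_applyLeft, Finset.prod_range_succ_comm, mul_pow, mul_assoc]
    exact hbob.map_traceRight

theorem hasCommonBound_final_of_isLinkDominated (h : IsLinkDominated ρ s t) :
    HasCommonBound (fun i => traceLeft (P.final (ρ i)))
      ((∏ j ∈ Finset.range n, (Fintype.card (Y (j + 1)) : ℂ)) * s *
        ((∏ j ∈ Finset.range (n + 1), (Fintype.card (X (j + 1)) : ℂ)) * t)) := by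
  simp only [traceLeft_final, Finset.prod_range_succ_comm, mul_assoc (Fintype.card _ : ℂ)]
  exact (P.isLinkDominated_afterAlice h le_rfl).hasCommonBound_traceRight_applyLeft_swapOuter
    P.bobLast_cptp

theorem hasCommonBound_final_of_hasCommonBound_traceLeft (hρ : ∀ i, 0 ≤ ρ i)
    (h : HasCommonBound (fun i => traceLeft (ρ i)) t) :
    HasCommonBound (fun i => traceLeft (P.final (ρ i)))
      ((∏ j ∈ Finset.range (n + 1), (Fintype.card (X (j + 1)) : ℂ)) ^ 2 * t) := by
  have hafter (i : ι) : 0 ≤ P.afterAlice (ρ i) n := P.afterAlice_nonneg (hρ i) le_rfl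
  have hmarginal := P.hasCommonBound_traceLeft_afterAlice hρ h le_rfl
  simp only [traceLeft_final, traceRight_applyLeft, Finset.prod_range_succ_comm, mul_pow, mul_assoc]
  exact (hmarginal.traceRight_swapOuter hafter).map P.bobLast_cptp

variable {q : A 0 → ℝ} {σ : A 0 → Matrix (B 0) (B 0) ℂ}
  {E : A 0 → Matrix (B (n + 1)) (B (n + 1)) ℂ}

theorem successProb_le_of_hasCommonBound (hE : IsPOVM E)
    (h : HasCommonBound
      (fun a => traceLeft (P.final (Matrix.single a a (1 : ℂ) ⊗ₖ ((q a : ℂ) • σ a)))) t) :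
    P.successProb q σ E ≤ t.re := by
  refine le_of_eq_of_le (Finset.sum_congr rfl fun a _ => ?_) (h.sum_trace_mul_re_le hE)
  rw [kronecker_smul, traceLeft_final_smul, Matrix.mul_smul, trace_smul, smul_eq_mul,
    Complex.re_ofReal_mul]

variable {T : Matrix (B 0) (B 0) ℂ}

theorem successProb_le_prod_card_mul_prod_card (hE : IsPOVM E) (hT : 0 ≤ T)
    (hσT : ∀ a, (q a : ℂ) • σ a ≤ T) :
    P.successProb q σ E ≤ ((∏ j ∈ Finset.range n, Fintype.card (Y (j + 1))) *
      ∏ j ∈ Finset.range (n + 1), Fintype.card (X (j + 1)) : ℕ) * T.trace.re := by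
  have hinput : IsLinkDominated
      (fun a => Matrix.single a a (1 : ℂ) ⊗ₖ ((q a : ℂ) • σ a)) 1 T.trace :=
    .of_le_kronecker (fun a => single_nonneg a) (fun a => trace_single_eq_same a 1) hT fun a =>
      kronecker_le_kronecker le_rfl (hσT a) (single_nonneg a) hT
  refine (P.successProb_le_of_hasCommonBound hE
    (P.hasCommonBound_final_of_isLinkDominated hinput)).trans_eq ?_
  rw [← Complex.re_ofReal_mul, mul_one, ← mul_assoc]
  push_cast
  rfl

theorem successProb_le_sq_prod_card (hE : IsPOVM E) (hσ : ∀ a, 0 ≤ (q a : ℂ) • σ a)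
    (hσT : ∀ a, (q a : ℂ) • σ a ≤ T) :
    P.successProb q σ E ≤
      ((∏ j ∈ Finset.range (n + 1), Fintype.card (X (j + 1))) ^ 2 : ℕ) * T.trace.re := by
  have hmarginal : HasCommonBound
      (fun a => traceLeft (Matrix.single a a (1 : ℂ) ⊗ₖ ((q a : ℂ) • σ a))) T.trace :=
    ⟨T, rfl, fun a => by simpa [traceLeft_kronecker] using hσT a⟩
  refine (P.successProb_le_of_hasCommonBound hE (P.hasCommonBound_final_of_hasCommonBound_traceLeft
    (fun a => kronecker_nonneg (single_nonneg a) (hσ a)) hmarginal)).trans_eq ?_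
  rw [← Complex.re_ofReal_mul]
  push_cast
  rfl

end Protocol

section Density

variable {a b : Type*} [Fintype b] {q : a → ℝ} {ρ : a → Matrix b b ℂ}

theorem IsDensity.smul_nonneg {σ : Matrix b b ℂ} (hσ : IsDensity σ) {r : ℝ} (hr : 0 ≤ r) :
    0 ≤ (r : ℂ) • σ :=
  (hσ.posSemidef.smul (Complex.zero_le_real.mpr hr)).nonneg

theorem IsDensity.sum_smul [Fintype a] (hq : ∀ x, 0 ≤ q x) (hq1 : ∑ x, q x = 1)
    (hρ : ∀ x, IsDensity (ρ x)) : IsDensity (∑ x, (q x : ℂ) • ρ x) where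
  posSemidef := posSemidef_sum _ fun x _ =>
    (hρ x).posSemidef.smul (Complex.zero_le_real.mpr (hq x))
  trace_eq_one := by
    simp only [Matrix.trace_sum, trace_smul, (hρ _).trace_eq_one, smul_eq_mul, mul_one]
    exact_mod_cast hq1

end Density

section MinEntropy

variable {a b : Type*} [Fintype a] [DecidableEq a] {q : a → ℝ} {ρ : a → Matrix b b ℂ}

theorem cqState_le_one_kronecker_iff [Finite b] {S : Matrix b b ℂ} :
    cqState q ρ ≤ 1 ⊗ₖ S ↔ ∀ x, (q x : ℂ) • ρ x ≤ S := by
  constructor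
  · intro h x
    have hblock : (cqState q ρ).submatrix (x, ·) (x, ·) = (q x : ℂ) • ρ x := by
      ext i j
      simp [cqState, Matrix.sum_apply, Matrix.single_apply]
    have hone : ((1 : Matrix a a ℂ) ⊗ₖ S).submatrix (x, ·) (x, ·) = S := by
      ext
      simp
    rw [← hblock, ← hone]
    exact submatrix_le_submatrix h (x, ·)
  · intro h
    have hdiff : (1 : Matrix a a ℂ) ⊗ₖ S - cqState q ρ =
        ∑ x, Matrix.single x x (1 : ℂ) ⊗ₖ (S - (q x : ℂ) • ρ x) := by
      ext i j
      simp [cqState, Matrix.sum_apply, Matrix.single_apply, Matrix.one_apply, mul_sub, ite_and]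
    rw [← sub_nonneg, hdiff]
    exact Finset.sum_nonneg fun x _ => kronecker_nonneg (single_nonneg x) (sub_nonneg.mpr (h x))

theorem minEntropy_cqState_sub_logb_le [Fintype b] (hq : ∀ x, 0 ≤ q x) (hq1 : ∑ x, q x = 1)
    (hρ : ∀ x, IsDensity (ρ x)) {p d : ℝ} (hp : 0 < p)
    (h : ∀ T : Matrix b b ℂ, 0 ≤ T → (∀ x, (q x : ℂ) • ρ x ≤ T) → p ≤ d * T.trace.re) :
    minEntropy (cqState q ρ) - Real.logb 2 (1 / p) ≤ Real.logb 2 d := by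
  have hfeasible (l : ℝ) (σ : Matrix b b ℂ) :
      (((2 : ℝ) ^ l) • ((1 : Matrix a a ℂ) ⊗ₖ σ) - cqState q ρ).PosSemidef ↔
        ∀ x, (q x : ℂ) • ρ x ≤ ((2 : ℝ) ^ l) • σ := by
    rw [← kronecker_smul, ← Matrix.le_iff, cqState_le_one_kronecker_iff]
  have hlower : Real.logb 2 p - Real.logb 2 d ≤ -minEntropy (cqState q ρ) := by
    rw [minEntropy, neg_neg]
    refine le_csInf ⟨0, _, .sum_smul hq hq1 hρ, (hfeasible _ _).mpr fun x => ?_⟩ ?_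
    · rw [Real.rpow_zero, one_smul]
      exact Finset.single_le_sum (f := fun x => (q x : ℂ) • ρ x)
        (fun x _ => (hρ x).smul_nonneg (hq x)) (Finset.mem_univ x)
    rintro l ⟨σ, hσ, hle⟩
    have hpd : p ≤ d * 2 ^ l := by
      simpa [trace_smul, hσ.trace_eq_one] using
        h _ (hσ.posSemidef.smul (by positivity)).nonneg ((hfeasible l σ).mp hle)
    have hd : 0 < d := pos_of_mul_pos_left (hp.trans_le hpd) (by positivity)
    have hlog := Real.logb_le_logb_of_le one_lt_two hp hpd
    rw [Real.logb_mul hd.ne' (by positivity), Real.logb_rpow two_pos (by norm_num)] at hlog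
    linarith
  rw [one_div, Real.logb_inv]
  linarith

end MinEntropy

section Logarithm

variable {b : ℝ}

theorem logb_natCast_mul_le (hb : 1 < b) (m k : ℕ) :
    Real.logb b (m * k : ℕ) ≤ Real.logb b m + Real.logb b k := by
  have hnonneg (j : ℕ) : 0 ≤ Real.logb b j :=
    div_nonneg (Real.log_natCast_nonneg j) (Real.log_pos hb).le
  rcases eq_or_ne (m * k) 0 with h | h
  · -- `Real.logb b 0` is `0`, not `-∞`
    rw [h, Nat.cast_zero, Real.logb_zero]
    exact add_nonneg (hnonneg m) (hnonneg k)
  · rw [Nat.cast_mul, Real.logb_mul (Nat.cast_ne_zero.mpr (left_ne_zero_of_mul h))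
      (Nat.cast_ne_zero.mpr (right_ne_zero_of_mul h))]

theorem logb_natCast_prod_le {ι : Type*} (hb : 1 < b) (s : Finset ι) (f : ι → ℕ) :
    Real.logb b (∏ i ∈ s, f i : ℕ) ≤ ∑ i ∈ s, Real.logb b (f i) := by
  induction s using Finset.cons_induction with
  | empty => simp
  | cons i s hi ih =>
    rw [Finset.prod_cons, Finset.sum_cons]
    exact (logb_natCast_mul_le hb _ _).trans (add_le_add_right ih _)

end Logarithm

end QComm

theorem mainTheorem3 {n : ℕ} {A B X Y : ℕ → Type*}
    [∀ i, Fintype (A i)] [∀ i, DecidableEq (A i)] [∀ i, Fintype (B i)] [∀ i, DecidableEq (B i)]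
    [∀ i, Fintype (X i)] [∀ i, DecidableEq (X i)] [∀ i, Fintype (Y i)] [∀ i, DecidableEq (Y i)]
    (P : QComm.Protocol n A B X Y)
    (q : A 0 → ℝ) (hq : ∀ a, 0 ≤ q a) (hq1 : ∑ a, q a = 1)
    (ρ : A 0 → Matrix (B 0) (B 0) ℂ) (hρ : ∀ a, QComm.IsDensity (ρ a))
    (p : ℝ) (hp : 0 < p) (hp1 : p ≤ 1)
    (hrec : ∃ E : A 0 → Matrix (B (n + 1)) (B (n + 1)) ℂ,
      QComm.IsPOVM E ∧ p ≤ P.successProb q ρ E) :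
    QComm.minEntropy (QComm.cqState q ρ) - Real.logb 2 (1 / p) ≤ P.qubitsBob + P.qubitsAlice ∧
    QComm.minEntropy (QComm.cqState q ρ) - Real.logb 2 (1 / p) ≤ 2 * P.qubitsAlice := by
  obtain ⟨E, hE, hpE⟩ := hrec
  have htotal := QComm.minEntropy_cqState_sub_logb_le hq hq1 hρ hp fun T hT hle =>
    hpE.trans (P.successProb_le_prod_card_mul_prod_card hE hT hle)
  have hsquare := QComm.minEntropy_cqState_sub_logb_le hq hq1 hρ hp fun T _ hle =>
    hpE.trans (P.successProb_le_sq_prod_card hE (fun a => (hρ a).smul_nonneg (hq a)) hle)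
  constructor
  · exact htotal.trans <| (QComm.logb_natCast_mul_le one_lt_two _ _).trans <|
      add_le_add (QComm.logb_natCast_prod_le one_lt_two _ _)
        (QComm.logb_natCast_prod_le one_lt_two _ _)
  · rw [Nat.cast_pow, Real.logb_pow] at hsquare
    exact hsquare.trans <| mul_le_mul_of_nonneg_left
      (QComm.logb_natCast_prod_le one_lt_two _ _) zero_le_two
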